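/- **Model.** $n$ asynchronous processes apply deterministic read-modify-write (RMW) primitives, explicit flushes and persistence fences to base objects. Each base object has a volatile value and a persistent value (in NVM), equal initially. An RMW changes only the volatile value. The system may at any time write the current volatile value of a base object to NVM (background flush). An explicit flush of $b$ by an agent is non-blocking: it takes effect (writes the then current value of $b$ to NVM) at some point between the flush and the agent's next persistence fence, inclusive. A system crash may occur at any time; it replaces all volatile values by the persistent ones, returns all processes to their initial states (abandoning pending operations), and starts a sequential recovery procedure, which applies the same primitives. New operations are invoked only after the recovery procedure has finished, and it finishes in finitely many steps unless interrupted by a crash. A process invokes an operation only when it has no pending one. A *set implementation* implements $\mathtt{insert}(v)$, $\mathtt{remove}(v)$ (the *update* operations) and $\mathtt{contains}(v)$, $v\in\mathbb Z$, on an initially empty set; $\mathtt{insert}(v)$ returns true iff $v$ is absent, the other two return true iff $v$ is present. It is *durable linearizable* if for every execution the history of invocations and responses, with crash events removed, is linearizable (an operation interrupted by a crash counts as pending). It is *lock-free* if in every infinite crash-free execution fragment, starting in a reachable configuration, in which processes take infinitely many steps, some operation completes. **Redundancy.** Let $E$ be an execution. A write to $b$ is *destructive* if it changes the value of $b$. An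 explicit flush $f$ of $b$ is *redundant* in $E$ if $b$ was flushed by an earlier explicit flush $f'$ and there is no destructive write to $b$ between $f'$ and $f$. A persistence fence is *redundant* in $E$ if there is an earlier persistence fence (by any process) and there is no non-redundant explicit flush between the two. A *psync* of a process consists of an explicit flush and the next persistence fence by that process; it is *redundant* if this fence is redundant. **Theorem.** In an $n$-process system, every durable linearizable lock-free set implementation has a (finite, crash-free) execution in which each of the $n$ processes has invoked an update operation, all these $n$ operations are pending together at the end, and at least $n-1$ of the processes have each performed a redundant psync during their operation. -/

import Mathlib

namespace PersistentSet

/-! ## The set type -/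

/-- The operations of the set type. -/
inductive SetOp where
  | insert (v : ℤ)
  | remove (v : ℤ)
  | contains (v : ℤ)

/-- The update operations are `insert` and `remove`. -/
def SetOp.IsUpdate : SetOp → Prop
  | .insert _ => True
  | .remove _ => True
  | .contains _ => False

/-- Sequential specification: the response of an operation on the abstract state `s`, and the
next abstract state. -/
def SetOp.apply : SetOp → Finset ℤ → Bool × Finset ℤ
  | .insert v, s => (decide (v ∉ s), Insert.insert v s)
  | .remove v, s => (decide (v ∈ s), s.erase v)
  | .contains v, s => (decide (v ∈ s), s)

/-- A sequence of operations with responses agrees with the sequential specification from the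
abstract state `s` on. -/
def Legal : Finset ℤ → List (SetOp × Bool) → Prop
  | _, [] => True
  | s, x :: t => x.2 = (x.1.apply s).1 ∧ Legal (x.1.apply s).2 t

/-! ## Events and memory -/

/-- Whoever applies primitives: one of the `n` processes, or the (sequential) recovery procedure
that runs after a crash. -/
inductive Agent (n : ℕ) where
  | proc (p : Fin n)
  | recovery

/-- The events of an execution. -/
inductive Event (n : ℕ) (Obj Val : Type*) where
  /-- process `p` invokes `op` -/
  | invoke (p : Fin n) (op : SetOp)
  /-- the pending operation of process `p` returns `r` -/
  | respond (p : Fin n) (r : Bool)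
  /-- a read-modify-write primitive on `b` that finds the value `old` and leaves `new` -/
  | rmw (a : Agent n) (b : Obj) (old new : Val)
  /-- an explicit flush of `b` -/
  | flush (a : Agent n) (b : Obj)
  /-- a persistence fence -/
  | fence (a : Agent n)
  /-- the system writes `b` back to NVM on its own: a background flush, or an outstanding explicit
  flush that takes effect before the corresponding fence -/
  | writeBack (b : Obj)
  /-- a full system crash -/
  | crash
  /-- the recovery procedure finishes -/
  | recovered

/-- An event of process `p`. -/
def Event.IsOf {n : ℕ} {Obj Val : Type*} (p : Fin n) : Event n Obj Val → Prop
  | .invoke q _ => q = p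
  | .respond q _ => q = p
  | .rmw a _ _ _ => a = .proc p
  | .flush a _ => a = .proc p
  | .fence a => a = .proc p
  | _ => False

/-- An event of the recovery procedure. -/
def Event.IsRecovery {n : ℕ} {Obj Val : Type*} : Event n Obj Val → Prop
  | .rmw a _ _ _ => a = .recovery
  | .flush a _ => a = .recovery
  | .fence a => a = .recovery
  | .recovered => True
  | _ => False

/-- State of the shared memory: the volatile value and the persistent value of each base object,
and for each agent the base objects for which it has issued an explicit flush that has not yet
taken effect. -/
structure Memory (n : ℕ) (Obj Val : Type*) where
  vol : Obj → Val
  nvm : Obj → Val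
  outstanding : Agent n → Set Obj

namespace Memory

variable {n : ℕ} {Obj Val : Type*}

open Classical in
/-- A modification takes effect in volatile memory only. -/
noncomputable def write (M : Memory n Obj Val) (b : Obj) (x : Val) : Memory n Obj Val :=
  { M with vol := Function.update M.vol b x }

open Classical in
/-- An explicit flush is non-blocking: it is only recorded as outstanding. -/
noncomputable def flush (M : Memory n Obj Val) (a : Agent n) (b : Obj) : Memory n Obj Val :=
  { M with outstanding := Function.update M.outstanding a (Insert.insert b (M.outstanding a)) }

open Classical in
/-- The base objects in `B` are written to NVM with their current values; this completes all
explicit flushes of these objects that were outstanding. -/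
noncomputable def persist (M : Memory n Obj Val) (B : Set Obj) : Memory n Obj Val :=
  { vol := M.vol
    nvm := fun b => if b ∈ B then M.vol b else M.nvm b
    outstanding := fun a => M.outstanding a \ B }

/-- A persistence fence forces those flushes of the agent to take effect that have not done so
yet. -/
noncomputable def fence (M : Memory n Obj Val) (a : Agent n) : Memory n Obj Val :=
  M.persist (M.outstanding a)

/-- A crash leaves only what is in NVM. -/
def crash (M : Memory n Obj Val) : Memory n Obj Val :=
  { vol := M.nvm, nvm := M.nvm, outstanding := fun _ => ∅ }

end Memory

/-! ## Implementations -/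

/-- The next step of a program: apply a primitive and pass to a new local state, or return with a
response in `R`. A read-modify-write primitive replaces the value `x` of `b` by `f x`; its response
is determined by `x`, so the new local state is a function of `x`. -/
inductive Action (Obj Val L R : Type*) where
  | rmw (b : Obj) (f : Val → Val) (k : Val → L)
  | flush (b : Obj) (k : L)
  | fence (k : L)
  | ret (r : R) (k : L)

/-- An implementation of the set type for `n` processes, from base objects `Obj` with values in
`Val`, with local states `L`. -/
structure Implementation (n : ℕ) (Obj Val L : Type*) where
  /-- initial value of each base object -/
  initVal : Obj → Val
  /-- initial state of each process -/
  initLocal : Fin n → L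
  /-- local state of a process after it invokes an operation -/
  start : Fin n → SetOp → L → L
  /-- next step of a process with a pending operation -/
  next : Fin n → L → Action Obj Val L Bool
  /-- state in which the recovery procedure starts -/
  recStart : L
  /-- next step of the recovery procedure -/
  recNext : L → Action Obj Val L Unit

/-- A configuration: the memory, the local state of each process, its pending operation if there
is one, and the state of the recovery procedure if that is running. -/
structure Config (n : ℕ) (Obj Val L : Type*) where
  mem : Memory n Obj Val
  loc : Fin n → L
  pending : Fin n → Option SetOp
  recovering : Option L

/-- `PrimStep a A M e M' l`: agent `a`, about to do `A`, applies a primitive to the memory `M`; the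
event is `e`, the new memory is `M'` and the new local state of `a` is `l`. -/
inductive PrimStep {n : ℕ} {Obj Val L R : Type*} (a : Agent n) :
    Action Obj Val L R → Memory n Obj Val → Event n Obj Val → Memory n Obj Val → L → Prop where
  | rmw (b : Obj) (f : Val → Val) (k : Val → L) (M : Memory n Obj Val) :
      PrimStep a (.rmw b f k) M (.rmw a b (M.vol b) (f (M.vol b))) (M.write b (f (M.vol b)))
        (k (M.vol b))
  | flush (b : Obj) (k : L) (M : Memory n Obj Val) :
      PrimStep a (.flush b k) M (.flush a b) (M.flush a b) k
  | fence (k : L) (M : Memory n Obj Val) :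
      PrimStep a (.fence k) M (.fence a) (M.fence a) k

/-- A sequence of events leads from one element to another through a labelled relation. -/
inductive Run {α ε : Type*} (step : α → ε → α → Prop) : α → List ε → α → Prop where
  | nil (c : α) : Run step c [] c
  | cons {c c' c'' : α} {e : ε} {E : List ε} :
      step c e c' → Run step c' E c'' → Run step c (e :: E) c''

/-! ## Histories and linearizability -/

/-- Invocations and responses of operations. -/
inductive HistEvent (n : ℕ) where
  | inv (p : Fin n) (op : SetOp)
  | res (p : Fin n) (r : Bool)

/-- The process of an invocation or response. -/
def HistEvent.proc {n : ℕ} : HistEvent n → Fin n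
  | .inv p _ => p
  | .res p _ => p

/-- The history of a sequence of events, without crash events. -/
def ops {n : ℕ} {Obj Val : Type*} (E : List (Event n Obj Val)) : List (HistEvent n) :=
  E.filterMap fun e => match e with
    | .invoke p op => some (.inv p op)
    | .respond p r => some (.res p r)
    | _ => none

/-- Operations of a history are named by the positions of their invocations. `Returns H i j r`: the
operation `i` has its matching response at position `j`, with value `r`: the next invocation or
response of the same process after `i` is a response. An operation that was pending at a crash
never has a matching response. -/
def Returns {n : ℕ} (H : List (HistEvent n)) (i j : ℕ) (r : Bool) : Prop :=
  ∃ p op, H[i]? = some (.inv p op) ∧ H[j]? = some (.res p r) ∧ i < j ∧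
    ∀ k e, i < k → k < j → H[k]? = some e → e.proc ≠ p

/-- Operation `i` returns before operation `i'` is invoked. -/
def Precedes {n : ℕ} (H : List (HistEvent n)) (i i' : ℕ) : Prop :=
  ∃ j r, Returns H i j r ∧ j < i'

/-- `S` is a linearization of `H`: a sequence of operations of `H` (name, operation, response) that
holds all complete operations with their responses, and some of the pending ones with suitable
responses, respects the precedence order of `H` and satisfies the sequential specification of an
initially empty set. -/
structure IsLinearization {n : ℕ} (H : List (HistEvent n)) (S : List (ℕ × SetOp × Bool)) :
    Prop where
  nodup : (S.map Prod.fst).Nodup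
  isOp : ∀ x ∈ S, ∃ p, H[x.1]? = some (.inv p x.2.1)
  complete : ∀ i j p op r, H[i]? = some (.inv p op) → Returns H i j r → (i, op, r) ∈ S
  order : S.Pairwise fun x y => ¬ Precedes H y.1 x.1
  legal : Legal ∅ (S.map Prod.snd)

namespace Implementation

variable {n : ℕ} {Obj Val L : Type*}

/-- The initial configuration. -/
def initConfig (I : Implementation n Obj Val L) : Config n Obj Val L where
  mem := { vol := I.initVal, nvm := I.initVal, outstanding := fun _ => ∅ }
  loc := I.initLocal
  pending := fun _ => none
  recovering := none

/-- The events that are possible in a configuration, and their effect. A process invokes an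
operation only if it has no pending one (executions are well-formed) and the recovery procedure is
not running. A crash is possible at any time: it resets all processes and starts the recovery
procedure. -/
inductive Step (I : Implementation n Obj Val L) :
    Config n Obj Val L → Event n Obj Val → Config n Obj Val L → Prop where
  | invoke (C : Config n Obj Val L) (p : Fin n) (op : SetOp) :
      C.recovering = none → C.pending p = none →
      Step I C (.invoke p op)
        { C with
          loc := Function.update C.loc p (I.start p op (C.loc p))
          pending := Function.update C.pending p (some op) }
  | respond (C : Config n Obj Val L) (p : Fin n) (op : SetOp) (r : Bool) (l : L) :
      C.recovering = none → C.pending p = some op → I.next p (C.loc p) = .ret r l →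
      Step I C (.respond p r)
        { C with
          loc := Function.update C.loc p l
          pending := Function.update C.pending p none }
  | prim (C : Config n Obj Val L) (p : Fin n) (op : SetOp) (e : Event n Obj Val)
      (M : Memory n Obj Val) (l : L) :
      C.recovering = none → C.pending p = some op →
      PrimStep (.proc p) (I.next p (C.loc p)) C.mem e M l →
      Step I C e { C with mem := M, loc := Function.update C.loc p l }
  | writeBack (C : Config n Obj Val L) (b : Obj) :
      Step I C (.writeBack b) { C with mem := C.mem.persist {b} }
  | crash (C : Config n Obj Val L) :
      Step I C .crash
        { mem := C.mem.crash
          loc := I.initLocal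
          pending := fun _ => none
          recovering := some I.recStart }
  | recPrim (C : Config n Obj Val L) (s : L) (e : Event n Obj Val)
      (M : Memory n Obj Val) (l : L) :
      C.recovering = some s → PrimStep .recovery (I.recNext s) C.mem e M l →
      Step I C e { C with mem := M, recovering := some l }
  | recDone (C : Config n Obj Val L) (s l : L) :
      C.recovering = some s → I.recNext s = .ret () l →
      Step I C .recovered { C with recovering := none }

/-- `E` is a (finite) execution of the implementation. -/
def IsExecution (I : Implementation n Obj Val L) (E : List (Event n Obj Val)) : Prop :=
  ∃ C, Run I.Step I.initConfig E C

/-- An infinite crash-free execution fragment, with configurations `c` and events `e`, that starts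
in a reachable configuration. -/
structure IsInfiniteFragment (I : Implementation n Obj Val L)
    (c : ℕ → Config n Obj Val L) (e : ℕ → Event n Obj Val) : Prop where
  reachable : ∃ E, Run I.Step I.initConfig E (c 0)
  step : ∀ i, I.Step (c i) (e i) (c (i + 1))
  crashFree : ∀ i, e i ≠ .crash

/-- Lock-freedom: if processes keep taking steps then some process completes its operation. (As
this applies to every suffix of a fragment, operations are completed again and again.) -/
def LockFree (I : Implementation n Obj Val L) : Prop :=
  ∀ c e, I.IsInfiniteFragment c e → (∃ᶠ i in Filter.atTop, ∃ p, (e i).IsOf p) →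
    ∃ i p r, e i = .respond p r

/-- The recovery procedure, unless interrupted by a crash, finishes after finitely many steps. -/
def RecoveryTerminates (I : Implementation n Obj Val L) : Prop :=
  ∀ c e, I.IsInfiniteFragment c e → ¬ ∃ᶠ i in Filter.atTop, (e i).IsRecovery

/-- Durable linearizability: the history of every execution, without crash events, is
linearizable. -/
def DurableLinearizable (I : Implementation n Obj Val L) : Prop :=
  ∀ E, I.IsExecution E → ∃ S, IsLinearization (ops E) S

end Implementation

/-! ## Redundant psyncs -/

section Redundant

variable {n : ℕ} {Obj Val : Type*}

/-- The event at position `k` is a destructive write to `b`: it changes the value of `b`. -/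
def DestructiveWrite (E : List (Event n Obj Val)) (k : ℕ) (b : Obj) : Prop :=
  ∃ a old new, E[k]? = some (.rmw a b old new) ∧ old ≠ new

/-- The event at position `k` is an explicit flush of `b`. -/
def FlushAt (E : List (Event n Obj Val)) (k : ℕ) (b : Obj) : Prop :=
  ∃ a, E[k]? = some (.flush a b)

/-- The event at position `k` is a persistence fence. -/
def FenceAt (E : List (Event n Obj Val)) (k : ℕ) : Prop :=
  ∃ a, E[k]? = some (.fence a)

/-- The explicit flush of `b` at position `f` is redundant: `b` was flushed explicitly before,
with no destructive write to `b` in between. -/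
def RedundantFlush (E : List (Event n Obj Val)) (f : ℕ) (b : Obj) : Prop :=
  FlushAt E f b ∧ ∃ f' < f, FlushAt E f' b ∧ ∀ k, f' < k → k < f → ¬ DestructiveWrite E k b

/-- The persistence fence at position `g` is redundant: there is an earlier persistence fence, with
no non-redundant explicit flush in between. -/
def RedundantFence (E : List (Event n Obj Val)) (g : ℕ) : Prop :=
  FenceAt E g ∧ ∃ g' < g, FenceAt E g' ∧
    ∀ k b, g' < k → k < g → FlushAt E k b → RedundantFlush E k b

/-- Process `p` invokes an update operation at position `i` of `E`, and this operation is still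
pending at the end of `E`. -/
def PendingUpdate (E : List (Event n Obj Val)) (p : Fin n) (i : ℕ) : Prop :=
  (∃ op, E[i]? = some (.invoke p op) ∧ op.IsUpdate) ∧
    ∀ k, i < k → E[k]? ≠ some .crash ∧ ∀ r, E[k]? ≠ some (.respond p r)

/-- After position `i`, process `p` performs a redundant psync: an explicit flush followed by the
next persistence fence of `p`, where this fence is redundant. -/
def RedundantPsyncAfter (E : List (Event n Obj Val)) (p : Fin n) (i : ℕ) : Prop :=
  ∃ f g b, i < f ∧ f < g ∧ E[f]? = some (.flush (.proc p) b) ∧ E[g]? = some (.fence (.proc p)) ∧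
    (∀ k, f < k → k < g → E[k]? ≠ some (.fence (.proc p))) ∧ RedundantFence E g

end Redundant

end PersistentSet

/-! Let a process run `insert v` alone, where `v` has not been used before and the process has no
outstanding flush. Suppose it responds without ever fencing while one of its flushes is outstanding.
With no background write-backs, NVM is then as it was before the invocation, so a crash after the
response and a crash instead of the invocation lead to the same configuration. The same recovery and
the same `contains v` can follow both crashes and return the same value, but durable linearizability
demands true in one case and false in the other (`run_not_atFence_memory`, `exists_run_atFence`).

Hence each process in turn can be stopped right before a fence that follows an unfenced flush of its
own. Distinct values keep every insertion fresh, and solo runs leave the stopped processes poised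
(`exists_run_all_atFence`). Now all fences are released back to back: nothing lies between
consecutive ones, so all but the first are redundant (`redundantPsyncAfter_fences`). -/

namespace PersistentSet

/-! ## Runs -/

namespace Run

variable {α ε : Type*} {step : α → ε → α → Prop}

theorem append {a b c : α} {E F : List ε} (h : Run step a E b) (h' : Run step b F c) :
    Run step a (E ++ F) c := by
  induction h with
  | nil => exact h'
  | cons hs _ ih => exact .cons hs (ih h')

theorem single {a b : α} {e : ε} (h : step a e b) : Run step a [e] b := .cons h (.nil b)

theorem mono {step' : α → ε → α → Prop} (hm : ∀ a e b, step a e b → step' a e b)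
    {a b : α} {E : List ε} (h : Run step a E b) : Run step' a E b := by
  induction h with
  | nil => exact .nil _
  | cons hs _ ih => exact .cons (hm _ _ _ hs) ih

/-- If no infinite run starts in `a`, then some finite run from `a` cannot be extended. -/
theorem exists_maximal (a : α)
    (h : ¬ ∃ (c : ℕ → α) (e : ℕ → ε), c 0 = a ∧ ∀ i, step (c i) (e i) (c (i + 1))) :
    ∃ E b, Run step a E b ∧ ∀ e b', ¬ step b e b' := by
  by_contra! hcon
  -- Successors exist only for states reachable from `a`, so they are chosen on this subtype and
  -- iterated.
  let R := {b : α // ∃ E, Run step a E b}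
  have hnext : ∀ b : R, ∃ x : ε × R, step b.1 x.1 x.2.1 := by
    rintro ⟨b, E, hE⟩
    obtain ⟨e, b', hs⟩ := hcon E b hE
    exact ⟨(e, ⟨b', E ++ [e], hE.append (single hs)⟩), hs⟩
  choose f hf using hnext
  let c : ℕ → R := fun i => Nat.rec ⟨a, [], .nil a⟩ (fun _ b => (f b).2) i
  exact h ⟨fun i => (c i).1, fun i => (f (c i)).1, rfl, fun i => hf (c i)⟩

end Run

/-! ## The sequential specification -/

/-- Absence of `v` is an invariant that only `insert v` can break. -/
theorem Legal.contains_false {v : ℤ} {r : Bool} : ∀ {T : List (SetOp × Bool)} {s : Finset ℤ},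
    Legal s T → v ∉ s → (∀ x ∈ T, x.1 ≠ .insert v) → (.contains v, r) ∈ T → r = false
  | [], _, _, _, _, hm => by simp at hm
  | (o, b) :: T, s, h, hv, hi, hm => by
    obtain ⟨h1, h2⟩ := h
    rcases List.mem_cons.1 hm with heq | hm
    · cases heq
      simpa [SetOp.apply, hv] using h1
    · refine contains_false h2 ?_ (fun x hx => hi x (List.mem_cons_of_mem _ hx)) hm
      have ho := hi _ List.mem_cons_self
      cases o with
      | insert w =>
        have : v ≠ w := fun h => ho (by rw [h])
        simp [SetOp.apply, hv, this]
      | remove w => simp [SetOp.apply, hv]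
      | contains w => simpa [SetOp.apply] using hv

/-- Dually, presence of `v` is an invariant that only `remove v` can break. -/
theorem Legal.contains_true {v : ℤ} {r : Bool} : ∀ {T : List (SetOp × Bool)} {s : Finset ℤ},
    Legal s T → v ∈ s → (∀ x ∈ T, x.1 ≠ .remove v) → (.contains v, r) ∈ T → r = true
  | [], _, _, _, _, hm => by simp at hm
  | (o, b) :: T, s, h, hv, hi, hm => by
    obtain ⟨h1, h2⟩ := h
    rcases List.mem_cons.1 hm with heq | hm
    · cases heq
      simpa [SetOp.apply, hv] using h1
    · refine contains_true h2 ?_ (fun x hx => hi x (List.mem_cons_of_mem _ hx)) hm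
      have ho := hi _ List.mem_cons_self
      cases o with
      | insert w => simp [SetOp.apply, hv]
      | remove w =>
        have : v ≠ w := fun h => ho (by rw [h])
        simp [SetOp.apply, hv, this]
      | contains w => simpa [SetOp.apply] using hv

theorem Legal.of_append {T' : List (SetOp × Bool)} :
    ∀ {T : List (SetOp × Bool)} {s : Finset ℤ}, Legal s (T ++ T') → ∃ s', Legal s' T'
  | [], s, h => ⟨s, h⟩
  | _ :: _, _, h => of_append h.2

/-! ## Two histories -/

section Histories

variable {n : ℕ}

theorem getElem?_append_length_add {α : Type*} (A B : List α) (i : ℕ) :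
    (A ++ B)[A.length + i]? = B[i]? := by
  rw [List.getElem?_append_right (by omega), Nat.add_sub_cancel_left]

theorem returns_succ {H : List (HistEvent n)} {i : ℕ} {p : Fin n} {op : SetOp} {r : Bool}
    (hi : H[i]? = some (.inv p op)) (hr : H[i + 1]? = some (.res p r)) :
    Returns H i (i + 1) r :=
  ⟨p, op, hi, hr, Nat.lt_succ_self i, fun _ _ _ _ => by omega⟩

/-- The linearization may include operations pending in `A`, but every operation in it is invoked in
the history, so none is `insert v`. -/
theorem IsLinearization.contains_false {A : List (HistEvent n)} {p : Fin n} {v : ℤ} {r : Bool}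
    (hA : ∀ q op, .inv q op ∈ A → op ≠ .insert v) {S : List (ℕ × SetOp × Bool)}
    (hS : IsLinearization (A ++ [.inv p (.contains v), .res p r]) S) : r = false := by
  have h0 := getElem?_append_length_add A [.inv p (.contains v), .res p r] 0
  have h1 := getElem?_append_length_add A [.inv p (.contains v), .res p r] 1
  have hm := hS.complete _ _ p _ r h0 (returns_succ h0 h1)
  refine hS.legal.contains_false (v := v) (Finset.notMem_empty v) ?_
    (List.mem_map.2 ⟨_, hm, rfl⟩)
  intro x hx
  obtain ⟨y, hy, rfl⟩ := List.mem_map.1 hx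
  obtain ⟨q, hq⟩ := hS.isOp y hy
  have := List.mem_of_getElem? hq
  rcases List.mem_append.1 this with h | h
  · exact hA q _ h
  · simp only [List.mem_cons, HistEvent.inv.injEq, reduceCtorEq, List.not_mem_nil, or_false] at h
    rw [h.2]; simp

/-- Both final operations are complete, hence linearized, and real-time order puts the insertion
first; no `remove v` is available to undo it. -/
theorem IsLinearization.contains_true {A : List (HistEvent n)} {p : Fin n} {v : ℤ} {r r' : Bool}
    (hA : ∀ q op, .inv q op ∈ A → op ≠ .remove v) {S : List (ℕ × SetOp × Bool)}
    (hS : IsLinearization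
      (A ++ [.inv p (.insert v), .res p r', .inv p (.contains v), .res p r]) S) : r = true := by
  have hg := getElem?_append_length_add A
    [.inv p (.insert v), .res p r', .inv p (.contains v), .res p r]
  have hret := returns_succ (hg 0) (hg 1)
  have hm := hS.complete _ _ p _ r' (hg 0) hret
  have hm' := hS.complete _ _ p _ r (hg 2) (returns_succ (hg 2) (hg 3))
  have hrem : ∀ x ∈ S, x.2.1 ≠ .remove v := by
    intro y hy
    obtain ⟨q, hq⟩ := hS.isOp y hy
    have := List.mem_of_getElem? hq
    rcases List.mem_append.1 this with h | h
    · exact hA q _ h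
    · simp only [List.mem_cons, HistEvent.inv.injEq, reduceCtorEq, List.not_mem_nil, or_false,
        false_or] at h
      rcases h with h | h <;> rw [h.2] <;> simp
  obtain ⟨S₁, S₂, rfl⟩ := List.append_of_mem hm
  have hin : (A.length + 2, SetOp.contains v, r) ∈ S₂ := by
    rcases List.mem_append.1 hm' with h | h
    · exact absurd ⟨_, _, hret, Nat.lt_succ_self _⟩
        ((List.pairwise_append.1 hS.order).2.2 _ h _ List.mem_cons_self)
    · simpa using h
  have hl := hS.legal
  rw [List.map_append, List.map_cons] at hl
  obtain ⟨s, -, hs⟩ := hl.of_append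
  -- Whatever state precedes the insertion, `v` is present after it.
  refine hs.contains_true (v := v) (by simp [SetOp.apply]) ?_ (List.mem_map.2 ⟨_, hin, rfl⟩)
  intro x hx
  obtain ⟨y, hy, rfl⟩ := List.mem_map.1 hx
  exact hrem y (by simp [hy])

end Histories

/-! ## Solo runs -/

variable {n : ℕ} {Obj Val L : Type*}

theorem ops_append (E F : List (Event n Obj Val)) : ops (E ++ F) = ops E ++ ops F :=
  List.filterMap_append

/-- The event is a primitive applied by the agent `a`. -/
def Event.IsPrim (a : Agent n) : Event n Obj Val → Prop
  | .rmw a' _ _ _ => a' = a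
  | .flush a' _ => a' = a
  | .fence a' => a' = a
  | _ => False

theorem PrimStep.isPrim {R : Type*} {a : Agent n} {A : Action Obj Val L R}
    {M M' : Memory n Obj Val} {e : Event n Obj Val} {l : L} (h : PrimStep a A M e M' l) :
    e.IsPrim a := by
  cases h <;> rfl

theorem PrimStep.exists_of_ne_ret {R : Type*} (a : Agent n) (A : Action Obj Val L R)
    (M : Memory n Obj Val) (h : ∀ r k, A ≠ .ret r k) : ∃ e M' l, PrimStep a A M e M' l := by
  cases A with
  | rmw b f k => exact ⟨_, _, _, .rmw b f k M⟩
  | flush b k => exact ⟨_, _, _, .flush b k M⟩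
  | fence k => exact ⟨_, _, _, .fence k M⟩
  | ret r k => exact absurd rfl (h r k)

theorem ops_eq_nil_of_isPrim {a : Agent n} {E : List (Event n Obj Val)}
    (h : ∀ e ∈ E, e.IsPrim a) : ops E = [] := by
  refine List.filterMap_eq_nil_iff.2 fun e he => ?_
  have := h e he
  cases e <;> simp_all [Event.IsPrim]

theorem Event.IsPrim.isOf {p : Fin n} {e : Event n Obj Val} (h : e.IsPrim (.proc p)) :
    e.IsOf p := by
  cases e <;> simp_all [Event.IsPrim, Event.IsOf]

theorem Event.IsPrim.isRecovery {e : Event n Obj Val} (h : e.IsPrim .recovery) :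
    e.IsRecovery := by
  cases e <;> simp_all [Event.IsPrim, Event.IsRecovery]

namespace Implementation

/-- The process `p` with a pending operation applies a primitive in a configuration that
satisfies `G`. -/
def ProcStep (I : Implementation n Obj Val L) (p : Fin n) (G : Config n Obj Val L → Prop)
    (C : Config n Obj Val L) (e : Event n Obj Val) (C' : Config n Obj Val L) : Prop :=
  G C ∧ C.recovering = none ∧ (∃ op, C.pending p = some op) ∧
    ∃ M l, PrimStep (.proc p) (I.next p (C.loc p)) C.mem e M l ∧
      C' = { C with mem := M, loc := Function.update C.loc p l }

/-- The recovery procedure applies a primitive. -/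
def RecStep (I : Implementation n Obj Val L)
    (C : Config n Obj Val L) (e : Event n Obj Val) (C' : Config n Obj Val L) : Prop :=
  ∃ s M l, C.recovering = some s ∧ PrimStep .recovery (I.recNext s) C.mem e M l ∧
    C' = { C with mem := M, recovering := some l }

variable {I : Implementation n Obj Val L} {p : Fin n} {G : Config n Obj Val L → Prop}
  {C C' : Config n Obj Val L} {e : Event n Obj Val} {E : List (Event n Obj Val)}

theorem ProcStep.step (h : I.ProcStep p G C e C') : I.Step C e C' := by
  obtain ⟨-, hr, ⟨op, hop⟩, M, l, hs, rfl⟩ := h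
  exact .prim C p op e M l hr hop hs

theorem RecStep.step (h : I.RecStep C e C') : I.Step C e C' := by
  obtain ⟨s, M, l, hr, hs, rfl⟩ := h
  exact .recPrim C s e M l hr hs

theorem run_procStep_frame (h : Run (I.ProcStep p G) C E C') :
    (∀ e ∈ E, e.IsPrim (.proc p)) ∧ C'.recovering = C.recovering ∧ C'.pending = C.pending ∧
      ∀ q ≠ p, C'.loc q = C.loc q := by
  induction h with
  | nil => simp
  | cons hs _ ih =>
    obtain ⟨-, -, -, M, l, hs, rfl⟩ := hs
    obtain ⟨h1, h2, h3, h4⟩ := ih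
    refine ⟨?_, h2, h3, fun q hq => ?_⟩
    · intro e he
      rcases List.mem_cons.1 he with rfl | he
      · exact hs.isPrim
      · exact h1 e he
    · rw [h4 q hq]; exact Function.update_of_ne hq _ _

theorem run_recStep_frame (h : Run I.RecStep C E C') :
    (∀ e ∈ E, e.IsPrim .recovery) ∧ C'.pending = C.pending ∧
      (C.recovering ≠ none → C'.recovering ≠ none) := by
  induction h with
  | nil => simp
  | cons hs _ ih =>
    obtain ⟨s, M, l, -, hs, rfl⟩ := hs
    obtain ⟨h1, h2, h3⟩ := ih
    refine ⟨?_, h2, fun _ => h3 (by simp)⟩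
    intro e he
    rcases List.mem_cons.1 he with rfl | he
    · exact hs.isPrim
    · exact h1 e he

/-- By lock-freedom, a process that runs alone reaches its response or leaves `G`. -/
theorem LockFree.exists_solo (hlf : I.LockFree) (G : Config n Obj Val L → Prop)
    (hreach : ∃ E, Run I.Step I.initConfig E C) (hr : C.recovering = none)
    (hp : C.pending p ≠ none) :
    ∃ E C', Run (I.ProcStep p G) C E C' ∧ (G C' → ∃ r k, I.next p (C'.loc p) = .ret r k) := by
  -- An infinite run would consist of primitives of `p` only, with no response, against
  -- lock-freedom.
  obtain ⟨E, C', hrun, hmax⟩ := Run.exists_maximal (step := I.ProcStep p G) C (by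
    rintro ⟨c, e, rfl, hs⟩
    have hprim : ∀ i, (e i).IsPrim (.proc p) := fun i => by
      obtain ⟨-, -, -, M, l, h, -⟩ := hs i
      exact h.isPrim
    obtain ⟨i, q, r, hi⟩ := hlf c e
      ⟨hreach, fun i => (hs i).step, fun i hi => by simpa [hi, Event.IsPrim] using hprim i⟩
      (Filter.Frequently.of_forall fun i => ⟨p, (hprim i).isOf⟩)
    simpa [hi, Event.IsPrim] using hprim i)
  refine ⟨E, C', hrun, fun hG => ?_⟩
  obtain ⟨-, h2, h3, -⟩ := run_procStep_frame hrun
  -- While `G` holds, the only action that is not a further `ProcStep` is a return.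
  by_contra! hne
  obtain ⟨e, M, l, hs⟩ := PrimStep.exists_of_ne_ret (.proc p) _ C'.mem hne
  exact hmax e _ ⟨hG, h2.trans hr, h3 ▸ Option.ne_none_iff_exists'.1 hp, M, l, hs, rfl⟩

/-- A maximal run of recovery primitives is finite by termination and can only stop where the
procedure returns. -/
theorem RecoveryTerminates.exists_run (hrec : I.RecoveryTerminates)
    (hreach : ∃ E, Run I.Step I.initConfig E C) (hr : C.recovering ≠ none) :
    ∃ E C', Run I.Step C E C' ∧ ops E = [] ∧ C'.recovering = none ∧ C'.pending = C.pending := by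
  obtain ⟨E, C', hrun, hmax⟩ := Run.exists_maximal (step := I.RecStep) C (by
    rintro ⟨c, e, rfl, hs⟩
    have hprim : ∀ i, (e i).IsPrim .recovery := fun i => by
      obtain ⟨s, M, l, -, h, -⟩ := hs i
      exact h.isPrim
    exact hrec c e
      ⟨hreach, fun i => (hs i).step, fun i hi => by simpa [hi, Event.IsPrim] using hprim i⟩
      (Filter.Frequently.of_forall fun i => (hprim i).isRecovery))
  obtain ⟨h1, h2, h3⟩ := run_recStep_frame hrun
  obtain ⟨s, hs⟩ := Option.ne_none_iff_exists'.1 (h3 hr)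
  have hret : ∃ r k, I.recNext s = .ret r k := by
    by_contra! hne
    obtain ⟨e, M, l, hst⟩ := PrimStep.exists_of_ne_ret .recovery _ C'.mem hne
    exact hmax e _ ⟨s, M, l, hs, hst, rfl⟩
  obtain ⟨r, k, hret⟩ := hret
  refine ⟨E ++ [.recovered], { C' with recovering := none },
    (hrun.mono fun _ _ _ h => h.step).append (.single (.recDone C' s k hs hret)), ?_, rfl, h2⟩
  rw [ops_append, ops_eq_nil_of_isPrim h1]; rfl

/-- After a crash, the recovery procedure followed by an operation of `p`, running alone. -/
theorem exists_recover_operation (hrec : I.RecoveryTerminates) (hlf : I.LockFree)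
    (p : Fin n) (op : SetOp) (hreach : ∃ E, Run I.Step I.initConfig E C)
    (hr : C.recovering ≠ none) (hp : C.pending p = none) :
    ∃ E C' r, Run I.Step C E C' ∧ ops E = [.inv p op, .res p r] := by
  obtain ⟨E₁, C₁, hrun₁, hops₁, hr₁, hp₁⟩ := hrec.exists_run hreach hr
  have hinv := Step.invoke (I := I) C₁ p op hr₁ (by rw [hp₁, hp])
  obtain ⟨E₀, hE₀⟩ := hreach
  have hrun₂ := hrun₁.append (.single hinv)
  obtain ⟨E₂, C₂, hrun, hret⟩ := hlf.exists_solo (p := p) (fun _ => True)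
    ⟨_, hE₀.append hrun₂⟩ hr₁ (by simp)
  obtain ⟨r, k, hret⟩ := hret trivial
  obtain ⟨h1, h2, h3, -⟩ := run_procStep_frame hrun
  refine ⟨_, _, r, (hrun₂.append (hrun.mono fun _ _ _ h => h.step)).append (.single
    (.respond C₂ p op r k (h2.trans hr₁) (by simp [h3]) hret)), ?_⟩
  rw [ops_append, ops_append, ops_append, hops₁, ops_eq_nil_of_isPrim h1]; rfl

/-! ## Reaching a fence with an outstanding flush -/

/-- The process `p` has an outstanding explicit flush and is about to apply a fence. -/
def AtFence (I : Implementation n Obj Val L) (p : Fin n) (C : Config n Obj Val L) : Prop :=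
  (∃ k, I.next p (C.loc p) = .fence k) ∧ (C.mem.outstanding (.proc p)).Nonempty

/-- `E` contains a flush by `p` that is not followed by a fence of `p`. -/
def UnfencedFlush (p : Fin n) (E : List (Event n Obj Val)) : Prop :=
  ∃ E₁ b E₂, E = E₁ ++ .flush (.proc p) b :: E₂ ∧ .fence (.proc p) ∉ E₂

/-- Of the primitives only a fence writes to NVM, and here every fence finds no outstanding flush
and persists nothing. The last alternative, a flush older than the run, is what the induction needs.
-/
theorem run_not_atFence_memory (h : Run (I.ProcStep p fun C => ¬ I.AtFence p C) C E C') :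
    C'.mem.nvm = C.mem.nvm ∧
    (∀ q ≠ p, C'.mem.outstanding (.proc q) = C.mem.outstanding (.proc q)) ∧
    ((C'.mem.outstanding (.proc p)).Nonempty → UnfencedFlush p E ∨
      ((C.mem.outstanding (.proc p)).Nonempty ∧ .fence (.proc p) ∉ E)) := by
  induction h with
  | nil => exact ⟨rfl, fun _ _ => rfl, fun h => .inr ⟨h, List.not_mem_nil⟩⟩
  | @cons C C₁ C' e E hs _ ih =>
    obtain ⟨hG, -, -, M, l, hs, rfl⟩ := hs
    obtain ⟨h1, h2, h3⟩ := ih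
    have hcons : UnfencedFlush p E → UnfencedFlush p (e :: E) := by
      rintro ⟨E₁, b, E₂, rfl, h⟩
      exact ⟨e :: E₁, b, E₂, rfl, h⟩
    generalize hA : I.next p (C.loc p) = A at hs
    cases hs with
    | rmw b f k =>
      refine ⟨h1, h2, fun hne => (h3 hne).imp hcons fun h => ⟨h.1, ?_⟩⟩
      simpa using h.2
    | flush b k =>
      refine ⟨h1, fun q hq => ?_, fun hne => ?_⟩
      · rw [h2 q hq]
        simp [Memory.flush, hq]
      · rcases h3 hne with h | h
        · exact .inl (hcons h)
        -- No later fence of `p` occurs, so this very flush is the unfenced one.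
        · exact .inl ⟨[], b, E, rfl, h.2⟩
    | fence k =>
      have hemp : C.mem.outstanding (.proc p) = ∅ := by
        by_contra hne
        exact hG ⟨⟨_, hA⟩, Set.nonempty_iff_ne_empty.2 hne⟩
      refine ⟨h1.trans ?_, fun q hq => (h2 q hq).trans ?_, fun hne => ?_⟩
      · simp [Memory.fence, Memory.persist, hemp]
      · simp [Memory.fence, Memory.persist, hemp]
      · rcases h3 hne with h | h
        · exact .inl (hcons h)
        · simp [Memory.fence, Memory.persist, hemp] at h

/-- In a configuration where `v` was never inserted, a process without outstanding flushes that
invokes `insert v` and runs alone reaches a fence with an outstanding flush. -/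
theorem exists_run_atFence (hrec : I.RecoveryTerminates) (hlf : I.LockFree)
    (hdl : I.DurableLinearizable) {E₀ : List (Event n Obj Val)}
    (hE₀ : Run I.Step I.initConfig E₀ C) (p : Fin n) (v : ℤ)
    (hops : ∀ q op, .inv q op ∈ ops E₀ → op ≠ .insert v ∧ op ≠ .remove v)
    (hr : C.recovering = none) (hp : C.pending p = none)
    (hout : C.mem.outstanding (.proc p) = ∅) :
    ∃ E C', Run I.Step C (.invoke p (.insert v) :: E) C' ∧ (∀ e ∈ E, e.IsPrim (.proc p)) ∧
      C'.recovering = none ∧ C'.pending = Function.update C.pending p (some (.insert v)) ∧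
      (∀ q ≠ p, C'.loc q = C.loc q) ∧
      (∀ q ≠ p, C'.mem.outstanding (.proc q) = C.mem.outstanding (.proc q)) ∧
      (∃ k, I.next p (C'.loc p) = .fence k) ∧ UnfencedFlush p E := by
  have hinv := Step.invoke (I := I) C p (.insert v) hr hp
  obtain ⟨E, C', hrun, hret⟩ := hlf.exists_solo (p := p) (fun C => ¬ I.AtFence p C)
    ⟨_, hE₀.append (.single hinv)⟩ hr (by simp)
  obtain ⟨h1, h2, h3, h4⟩ := run_procStep_frame hrun
  obtain ⟨h5, h6, h7⟩ := run_not_atFence_memory hrun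
  have hrun' : Run I.Step C (.invoke p (.insert v) :: E) C' :=
    .cons hinv (hrun.mono fun _ _ _ h => h.step)
  by_cases hat : I.AtFence p C'
  · refine ⟨E, C', hrun', h1, h2.trans hr, ?_, fun q hq => ?_, h6, hat.1, ?_⟩
    · rw [h3]
    · rw [h4 q hq]; exact Function.update_of_ne hq _ _
    · rcases h7 hat.2 with h | h
      · exact h
      -- The outstanding flush cannot predate the invocation.
      · exact absurd hout h.1.ne_empty
  · exfalso
    obtain ⟨r', k, hret⟩ := hret hat
    have hresp := Step.respond (I := I) C' p (.insert v) r' k (h2.trans hr) (by simp [h3]) hret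
    have hcrash := Step.crash (I := I) C
    have hcrash' := Step.crash (I := I)
      { C' with
        loc := Function.update C'.loc p k
        pending := Function.update C'.pending p none }
    -- A crash keeps only NVM, which is unchanged, so both crashes end in the same configuration and
    -- `F` below extends both executions.
    simp only [Memory.crash, h5] at hcrash'
    obtain ⟨F, D, r, hF, hopsF⟩ := exists_recover_operation hrec hlf p (.contains v)
      ⟨_, hE₀.append (.single hcrash)⟩ (by simp) rfl
    obtain ⟨S, hS⟩ := hdl _ ⟨_, (hE₀.append (.single hcrash)).append hF⟩
    obtain ⟨S', hS'⟩ := hdl _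
      ⟨_, (((hE₀.append hrun').append (.single hresp)).append (.single hcrash')).append hF⟩
    have e1 : ops ((E₀ ++ [.crash]) ++ F) =
        ops E₀ ++ [.inv p (.contains v), .res p r] := by
      rw [ops_append, ops_append, hopsF]; simp [ops]
    have e2 : ops ((((E₀ ++ (.invoke p (.insert v) :: E)) ++ [.respond p r']) ++ [.crash]) ++ F) =
        ops E₀ ++ [.inv p (.insert v), .res p r', .inv p (.contains v), .res p r] := by
      have : ops (.invoke p (.insert v) :: E) = .inv p (.insert v) :: ops E := rfl
      rw [ops_append, ops_append, ops_append, ops_append, hopsF, this, ops_eq_nil_of_isPrim h1]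
      simp [ops]
    rw [e1] at hS
    rw [e2] at hS'
    have hf := hS.contains_false fun q op h => (hops q op h).1
    have ht := hS'.contains_true fun q op h => (hops q op h).2
    simp [hf] at ht

/-! ### Assembling the execution -/

/-- The first `k` processes can be brought one after the other to a fence that follows a flush. -/
theorem exists_run_all_atFence (hrec : I.RecoveryTerminates) (hlf : I.LockFree)
    (hdl : I.DurableLinearizable) (k : ℕ) (hk : k ≤ n) :
    ∃ (E : List (Event n Obj Val)) (C : Config n Obj Val L), Run I.Step I.initConfig E C ∧
      .crash ∉ E ∧ (∀ p r, .respond p r ∉ E) ∧ C.recovering = none ∧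
      (∀ q op, .inv q op ∈ ops E → q.val < k ∧ op = .insert (q.val : ℤ)) ∧
      (∀ p : Fin n, k ≤ p.val → C.pending p = none ∧ C.mem.outstanding (.proc p) = ∅) ∧
      ∀ p : Fin n, p.val < k → C.pending p ≠ none ∧ (∃ l, I.next p (C.loc p) = .fence l) ∧
        ∃ E₁ E₂, E = E₁ ++ .invoke p (.insert (p.val : ℤ)) :: E₂ ∧ UnfencedFlush p E₂ := by
  induction k with
  | zero =>
    exact ⟨[], I.initConfig, .nil _, by simp, by simp, rfl, by simp [ops],
      fun p _ => ⟨rfl, rfl⟩, fun p hp => absurd hp (Nat.not_lt_zero _)⟩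
  | succ k ih =>
    obtain ⟨E, C, hrun, hnc, hnr, hr, hops, hidle, hat⟩ := ih (by omega)
    let p : Fin n := ⟨k, hk⟩
    obtain ⟨F, C', hF, hprim, hr', hpend, hloc, hout, hfence, hflush⟩ :=
      -- The process index serves as the value: earlier processes inserted smaller ones.
      exists_run_atFence hrec hlf hdl hrun p (p.val : ℤ)
        (fun q op h => by
          obtain ⟨h1, rfl⟩ := hops q op h
          have : q.val ≠ p.val := h1.ne
          simpa using this) hr (hidle p le_rfl).1 (hidle p le_rfl).2
    have hmemF : ∀ e : Event n Obj Val, ¬ e.IsPrim (.proc p) →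
        e ≠ .invoke p (.insert (p.val : ℤ)) → e ∉ E →
        e ∉ E ++ .invoke p (.insert (p.val : ℤ)) :: F := by
      intro e h1 h2 h3 h
      rcases List.mem_append.1 h with h | h
      · exact h3 h
      · rcases List.mem_cons.1 h with h | h
        · exact h2 h
        · exact h1 (hprim e h)
    refine ⟨E ++ .invoke p (.insert (p.val : ℤ)) :: F, C', hrun.append hF, ?_, ?_, hr', ?_, ?_, ?_⟩
    · exact hmemF _ (by simp [Event.IsPrim]) (by simp) hnc
    · exact fun q r => hmemF _ (by simp [Event.IsPrim]) (by simp) (hnr q r)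
    · intro q op h
      have e1 : ops (.invoke p (.insert (p.val : ℤ)) :: F) =
          .inv p (.insert (p.val : ℤ)) :: ops F := rfl
      rw [ops_append, e1, ops_eq_nil_of_isPrim hprim] at h
      rcases List.mem_append.1 h with h | h
      · exact ⟨(hops q op h).1.trans (Nat.lt_succ_self k), (hops q op h).2⟩
      · obtain ⟨rfl, rfl⟩ := by simpa using h
        exact ⟨Nat.lt_succ_self k, rfl⟩
    · intro q hq
      have hne : q ≠ p := fun h => by simp [h, p] at hq
      rw [hpend, hout q hne, Function.update_of_ne hne]
      exact hidle q (by omega)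
    · intro q hq
      by_cases hne : q = p
      · rw [hne]
        exact ⟨by simp [hpend], hfence, E, F, rfl, hflush⟩
      · have hqk : q.val < k := by
          have : q.val ≠ k := fun h => hne (Fin.ext h)
          omega
        obtain ⟨h1, h2, E₁, E₂, rfl, E₃, b, E₄, rfl, h4⟩ := hat q hqk
        rw [hpend, hloc q hne, Function.update_of_ne hne]
        -- The appended block has only events of `p`, hence no fence of `q`, so the flush of `q`
        -- stays unfenced.
        refine ⟨h1, h2, E₁, E₃ ++ .flush (.proc q) b ::
          (E₄ ++ .invoke p (.insert (p.val : ℤ)) :: F), by simp, E₃, b, _, rfl, ?_⟩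
        intro h
        rcases List.mem_append.1 h with h | h
        · exact h4 h
        · rcases List.mem_cons.1 h with h | h
          · simp at h
          · exact hne (by simpa [Event.IsPrim] using hprim _ h)

/-- Processes that are about to apply a fence can do so one after the other. -/
theorem exists_run_fences : ∀ (ps : List (Fin n)) (C : Config n Obj Val L), ps.Nodup →
    C.recovering = none →
    (∀ p ∈ ps, C.pending p ≠ none ∧ ∃ l, I.next p (C.loc p) = .fence l) →
    ∃ C', Run I.Step C (ps.map fun p => .fence (.proc p)) C'
  | [], C, _, _, _ => ⟨C, .nil C⟩
  | p :: ps, C, hnd, hr, h => by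
    obtain ⟨hp, l, hl⟩ := h p List.mem_cons_self
    obtain ⟨op, hop⟩ := Option.ne_none_iff_exists'.1 hp
    have hs := Step.prim (I := I) C p op (.fence (.proc p)) (C.mem.fence (.proc p)) l hr hop
      (by rw [hl]; exact .fence l C.mem)
    obtain ⟨C', hC'⟩ := exists_run_fences ps
      { C with mem := C.mem.fence (.proc p), loc := Function.update C.loc p l }
      (List.nodup_cons.1 hnd).2 hr (by
        intro q hq
        have hne : q ≠ p := fun h => (List.nodup_cons.1 hnd).1 (h ▸ hq)
        simpa [Function.update_of_ne hne] using h q (List.mem_cons_of_mem _ hq))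
    exact ⟨C', .cons hs hC'⟩

end Implementation

/-! ### Redundancy of the final fences -/

/-- If every process fences in turn, after a flush that it has not fenced yet, then all but the
first perform a redundant psync. -/
theorem redundantPsyncAfter_fences {E₁ E₂ : List (Event n Obj Val)} {e : Event n Obj Val}
    {p : Fin n} (hp : p.val ≠ 0) (h : Implementation.UnfencedFlush p E₂) :
    RedundantPsyncAfter
      (E₁ ++ e :: E₂ ++ (List.finRange n).map fun p => .fence (.proc p)) p E₁.length := by
  obtain ⟨E₃, b, E₄, rfl, h4⟩ := h
  set A := E₁ ++ e :: (E₃ ++ Event.flush (.proc p) b :: E₄) with hA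
  set F : List (Event n Obj Val) := (List.finRange n).map fun p => .fence (.proc p) with hF
  have hfence : ∀ q : Fin n, (A ++ F)[A.length + q.val]? = some (.fence (.proc q)) := by
    intro q
    rw [getElem?_append_length_add]
    simp [hF]
  have hlen : A.length = E₁.length + 1 + E₃.length + 1 + E₄.length := by
    simp [hA]; omega
  have hsplit : A ++ F = (E₁ ++ e :: E₃) ++ Event.flush (.proc p) b :: (E₄ ++ F) := by
    simp [hA]
  have hlen' : (E₁ ++ e :: E₃).length = E₁.length + 1 + E₃.length := by simp +arith
  -- The earlier fence is that of process `p.val - 1`, which exists since `p.val ≠ 0`. It is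
  -- adjacent, so the condition on flushes in between is vacuous.
  refine ⟨E₁.length + 1 + E₃.length, A.length + p.val, b, by omega, by omega, ?_, hfence p, ?_,
    ⟨_, hfence p⟩, A.length + (p.val - 1), by omega, ⟨_, hfence ⟨p.val - 1, by omega⟩⟩, ?_⟩
  · rw [hsplit, ← hlen', List.getElem?_append_right le_rfl]; simp
  · intro k hk1 hk2 hk
    -- A position before the final block lies in `E₄`, which has no fence of `p`; one inside it
    -- belongs to a smaller process.
    rcases lt_or_ge k A.length with hlt | hge
    · obtain ⟨m, rfl⟩ := Nat.exists_eq_add_of_lt hk1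
      rw [hsplit, ← hlen', add_assoc, getElem?_append_length_add, List.getElem?_cons_succ,
        List.getElem?_append_left (by omega)] at hk
      exact h4 (List.mem_of_getElem? hk)
    · obtain ⟨m, rfl⟩ := Nat.exists_eq_add_of_le hge
      have hm : m < p.val := by omega
      have := hfence ⟨m, by omega⟩
      rw [hk] at this
      have := congrArg Fin.val (by simpa using this : p = ⟨m, _⟩)
      simp at this
      omega
  · intro k b h1 h2
    omega

end PersistentSet

theorem mainTheorem1 {n : ℕ} {Obj Val L : Type*}
    (I : PersistentSet.Implementation n Obj Val L)
    (hrec : I.RecoveryTerminates) (hlf : I.LockFree) (hdl : I.DurableLinearizable) :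
    ∃ E : List (PersistentSet.Event n Obj Val),
      I.IsExecution E ∧ .crash ∉ E ∧
      ∃ i : Fin n → ℕ, (∀ p, PersistentSet.PendingUpdate E p (i p)) ∧
        ∃ P : Finset (Fin n), n ≤ P.card + 1 ∧
          ∀ p ∈ P, PersistentSet.RedundantPsyncAfter E p (i p) := by
  obtain ⟨E, C, hrun, hnc, hnr, hr, -, -, hat⟩ :=
    PersistentSet.Implementation.exists_run_all_atFence hrec hlf hdl n le_rfl
  obtain ⟨C', hC'⟩ := PersistentSet.Implementation.exists_run_fences (List.finRange n) C
    (List.nodup_finRange n) hr fun p _ => ⟨(hat p p.isLt).1, (hat p p.isLt).2.1⟩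
  choose E₁ E₂ hE hflush using fun p : Fin n => (hat p p.isLt).2.2
  have hcrash : .crash ∉ E ++ (List.finRange n).map fun p => .fence (.proc p) := by
    simp [hnc]
  have hresp : ∀ p r, .respond p r ∉ E ++ (List.finRange n).map fun p => .fence (.proc p) := by
    simp [hnr]
  refine ⟨_, ⟨C', hrun.append hC'⟩, hcrash, fun p => (E₁ p).length, fun p => ⟨?_, ?_⟩,
    -- Process 0 fences first and is the only one left out.
    Finset.univ.filter fun p => p.val ≠ 0, ?_, fun p hp => ?_⟩
  · refine ⟨.insert (p.val : ℤ), ?_, trivial⟩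
    rw [hE p, List.append_assoc, List.getElem?_append_right le_rfl]
    simp
  · exact fun k _ => ⟨fun h => hcrash (List.mem_of_getElem? h),
      fun r h => hresp p r (List.mem_of_getElem? h)⟩
  · cases n with
    | zero => simp
    | succ n =>
      have : (Finset.univ.filter fun p : Fin (n + 1) => p.val ≠ 0) = Finset.univ.erase 0 := by
        ext p
        simp
      rw [this, Finset.card_erase_of_mem (Finset.mem_univ _)]
      simp
  · have := PersistentSet.redundantPsyncAfter_fences (E₁ := E₁ p)
      (e := .invoke p (.insert (p.val : ℤ))) (by simpa using hp) (hflush p)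
    rwa [← hE p] at this
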